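/- Let $(f_n)_{n\ge 0}$ be a real recurrence sequence, i.e. a sequence of real numbers for which there are $h\ge 0$ and constants $c_1,\dots,c_h\in\mathbb{R}$ with $f_{n+h}=c_1f_{n+h-1}+\dots+c_hf_n$ for all $n\ge 0$, and suppose that $(f_n)$ is not eventually zero (that is, $f_n\neq 0$ for infinitely many $n$). For all sufficiently large $n$ (and for all $n\ge 0$ if $c_h\neq 0$) one can write $f_n=\sum_{k}P_k(n)\gamma_k^n$, a finite sum with pairwise distinct nonzero $\gamma_k\in\mathbb{C}$ and nonzero polynomials $P_k\in\mathbb{C}[x]$; the $\gamma_k$, which are uniquely determined by $(f_n)$, are the (nonzero) characteristic roots of $(f_n)$, and those of largest modulus are its dominating roots. If no dominating root of $(f_n)$ is a positive real number, then each of the sets $\{n\in\mathbb{N}: f_n>0\}$ and $\{n\in\mathbb{N}: f_n<0\}$ has a positive natural density; that is, for each of these sets $A$ the limit $\lim_{x\to\infty}x^{-1}\,\#\{n\le x: n\in A\}$ exists and is positive. -/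

import Mathlib

open Filter Topology

/-- A real sequence is a *recurrence sequence* if it satisfies some homogeneous linear recurrence
with constant real coefficients, for all `n ≥ 0`. -/
def IsRecurrenceSequence (f : ℕ → ℝ) : Prop :=
  ∃ E : LinearRecurrence ℝ, E.IsSolution f

/-- `f` is given by the generalized power sum `∑ γ, P γ (n) * γ ^ n`, where `P` assigns to each of
finitely many complex numbers `γ` (the support of `P`) a nonzero complex polynomial `P γ`.
The identity is required for all large `n`: if the trailing coefficient of the recurrence
vanishes, then the characteristic root `0` makes finitely many initial terms exceptional. -/
def IsPowerSum (f : ℕ → ℝ) (P : ℂ →₀ Polynomial ℂ) : Prop :=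
  ∀ᶠ n : ℕ in atTop, (f n : ℂ) = P.sum fun γ p => p.eval (n : ℂ) * γ ^ n

/-- The nonzero (characteristic) roots of `f`: the nonzero `γ` that occur in a power sum
representation of `f` with a nonzero polynomial coefficient. (A root `0` affects only finitely
many terms, and is never of largest modulus unless `f` is eventually zero.) -/
def IsCharRoot (f : ℕ → ℝ) (γ : ℂ) : Prop :=
  γ ≠ 0 ∧ ∃ P : ℂ →₀ Polynomial ℂ, IsPowerSum f P ∧ γ ∈ P.support

/-- The dominating roots of `f` are its roots of largest modulus. -/
def IsDominatingRoot (f : ℕ → ℝ) (γ : ℂ) : Prop :=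
  IsCharRoot f γ ∧ ∀ δ : ℂ, IsCharRoot f δ → ‖δ‖ ≤ ‖γ‖

/-- The set `A` of natural numbers has natural density `d`:
the limit of `#{n ≤ x : n ∈ A} / x` as `x → ∞` exists and equals `d`. -/
def HasNaturalDensity (A : Set ℕ) (d : ℝ) : Prop :=
  Tendsto (fun x : ℕ => ({n : ℕ | n ≤ x ∧ n ∈ A}.ncard : ℝ) / (x : ℝ)) atTop (𝓝 d)

/-!
Why each sign occurs with positive density.

A recurrence sequence is eventually a power sum `∑ γ, P γ (n) * γ ^ n` over nonzero `γ`: the space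
of solutions is the sum of the generalized eigenspaces of the shift
(`mem_eventualPowerSums_of_isSolution`). Let `ρ` be the largest modulus of a root and `D` the largest
degree of a coefficient of a root of modulus `ρ`. Dividing by `n ^ D * ρ ^ n` changes no sign and
gives a bounded sequence `F` with `F - g → 0`, where `g n = ∑ α ∈ S, c α * α ^ n` is a nonzero
trigonometric sum with frequencies on the unit circle (`exists_leading_trigSum`).

*Existence of the density.* All moments of `F` have mean values, because powers of `g` are again
trigonometric sums. By Weierstrass approximation `φ ∘ F` has a mean value for every continuous `φ`
(`exists_hasMean_comp`). The indicator of positivity is approximated by such `φ ∘ F` as soon as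
`g` is rarely small, which holds if no quotient of distinct frequencies is a root of unity: a
pigeonhole argument reduces the claim to the differences `g (n + h) - β ^ h * g n`, which have one
frequency less (`rarelySmall_trigSum`). In general, one passes to the residue classes modulo some
`q`, along which the roots are `q`-th powers; for a suitable `q` no quotient of distinct ones is a
root of unity (`exists_hasMean_posInd_of_powerSum`). No equidistribution theorem on tori is
needed.

*Positivity.* If no root of modulus `ρ` is positive, the frequency `1` does not occur in `g`.
Hence `F` has mean value `0`, while `F ^ 2` has mean value `∑ ‖c α‖ ^ 2 > 0` by Parseval's identity.
As `F` is bounded, it is positive with positive frequency (`pos_of_hasMean_posInd`). The negative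
terms are the positive terms of `-f`.

The roots in the hypothesis are those of an arbitrary power sum for `f`; they agree with the roots
of the chosen one because a nonzero power sum does not vanish eventually
(`eq_zero_of_eventually_powerSum_eq_zero`).
-/

namespace RecurrenceSign

open Finset

/-! ### Cesàro means -/

/-- The sequence `u` has mean value `a`: its Cesàro averages converge to `a`. -/
def HasMean {E : Type*} [NormedAddCommGroup E] [NormedSpace ℝ E] (u : ℕ → E) (a : E) : Prop :=
  Tendsto (fun N : ℕ => (N : ℝ)⁻¹ • ∑ n ∈ range N, u n) atTop (𝓝 a)

section General

variable {E : Type*} [NormedAddCommGroup E] [NormedSpace ℝ E] {u v : ℕ → E} {a b : E}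

lemma HasMean.add (hu : HasMean u a) (hv : HasMean v b) :
    HasMean (fun n => u n + v n) (a + b) := by
  simpa [HasMean, sum_add_distrib, smul_add] using Tendsto.add hu hv

lemma HasMean.sum {ι : Type*} {s : Finset ι} {u : ι → ℕ → E} {a : ι → E}
    (h : ∀ i ∈ s, HasMean (u i) (a i)) :
    HasMean (fun n => ∑ i ∈ s, u i n) (∑ i ∈ s, a i) := by
  have := tendsto_finsetSum s h
  simpa only [HasMean, sum_comm (s := range _) (t := s), smul_sum] using this

lemma hasMean_of_tendsto (hu : Tendsto u atTop (𝓝 a)) : HasMean u a :=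
  hu.cesaro_smul

lemma HasMean.congr_of_tendsto_sub (hu : HasMean u a)
    (h : Tendsto (fun n => v n - u n) atTop (𝓝 0)) : HasMean v a := by
  simpa using hu.add (hasMean_of_tendsto h)

lemma HasMean.const_mul {u : ℕ → ℂ} {a : ℂ} (c : ℂ) (hu : HasMean u a) :
    HasMean (fun n => c * u n) (c * a) := by
  have := Tendsto.const_mul c hu
  simpa only [HasMean, ← mul_sum, mul_smul_comm] using this

lemma HasMean.const_mul_real {u : ℕ → ℝ} {a : ℝ} (c : ℝ) (hu : HasMean u a) :
    HasMean (fun n => c * u n) (c * a) := by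
  have := Tendsto.const_mul c hu
  simpa only [HasMean, ← mul_sum, mul_smul_comm] using this

lemma HasMean.re {u : ℕ → ℂ} {a : ℂ} (hu : HasMean u a) :
    HasMean (fun n => (u n).re) a.re := by
  have := (Complex.continuous_re.tendsto a).comp hu
  simpa [HasMean, Function.comp_def] using this

end General

/-- A real sequence that is, for every `ε > 0`, eventually within `ε` of some convergent sequence
is itself convergent. -/
lemma exists_tendsto_of_approx {x : ℕ → ℝ}
    (h : ∀ ε > 0, ∃ (y : ℕ → ℝ) (l : ℝ), Tendsto y atTop (𝓝 l) ∧ ∀ᶠ N in atTop, |x N - y N| ≤ ε) :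
    ∃ l, Tendsto x atTop (𝓝 l) := by
  apply cauchySeq_tendsto_of_complete
  rw [Metric.cauchySeq_iff']
  intro ε hε
  obtain ⟨y, l, hy, hxy⟩ := h (ε / 5) (by positivity)
  have hy' := (Metric.tendsto_nhds.1 hy) (ε / 5) (by positivity)
  obtain ⟨N, hN⟩ := eventually_atTop.1 (hxy.and hy')
  refine ⟨N, fun n hn => ?_⟩
  obtain ⟨h1, h2⟩ := hN n hn
  obtain ⟨h3, h4⟩ := hN N le_rfl
  rw [Real.dist_eq] at *
  rw [abs_lt] at *
  rw [abs_le] at *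
  constructor <;> linarith

lemma abs_avg_sub_le {u v w : ℕ → ℝ} (N : ℕ) (h : ∀ n, |u n - v n| ≤ w n) :
    |(N : ℝ)⁻¹ • ∑ n ∈ range N, u n - (N : ℝ)⁻¹ • ∑ n ∈ range N, v n| ≤
      (N : ℝ)⁻¹ * ∑ n ∈ range N, w n := by
  rw [← smul_sub, ← sum_sub_distrib, smul_eq_mul, abs_mul, abs_of_nonneg (by positivity)]
  gcongr
  exact (abs_sum_le_sum_abs _ _).trans (sum_le_sum fun n _ => h n)

/-- By Weierstrass approximation, a bounded real sequence all of whose moments exist has a mean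
value after composition with any continuous function. -/
lemma exists_hasMean_comp {F : ℕ → ℝ} {C : ℝ} (hC : ∀ n, |F n| ≤ C)
    (hF : ∀ k : ℕ, ∃ a, HasMean (fun n => F n ^ k) a) {φ : ℝ → ℝ} (hφ : Continuous φ) :
    ∃ a, HasMean (fun n => φ (F n)) a := by
  apply exists_tendsto_of_approx
  intro ε hε
  obtain ⟨p, hp⟩ := exists_polynomial_near_of_continuousOn (-C) C φ hφ.continuousOn ε hε
  choose a ha using hF
  refine ⟨_, ∑ i ∈ range (p.natDegree + 1), p.coeff i * a i,
    HasMean.sum fun i _ => (ha i).const_mul_real (p.coeff i), ?_⟩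
  filter_upwards [eventually_gt_atTop 0] with N hN
  refine (abs_avg_sub_le (w := fun _ => ε) N fun n => ?_).trans ?_
  · rw [← Polynomial.eval_eq_sum_range, abs_sub_comm]
    exact (hp _ (abs_le.1 (hC n))).le
  · have : (N : ℝ) ≠ 0 := by positivity
    simp [field]

/-! ### Trigonometric sums -/

/-- The trigonometric sum `∑ α ∈ S, c α * α ^ n`, a sequence in `n`; the frequencies `α` are meant
to lie on the unit circle. -/
def trigSum (S : Finset ℂ) (c : ℂ → ℂ) (n : ℕ) : ℂ := ∑ α ∈ S, c α * α ^ n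

lemma hasMean_pow {α : ℂ} (hα : ‖α‖ = 1) :
    HasMean (fun n => α ^ n) (if α = 1 then 1 else 0) := by
  split_ifs with h
  · simpa [h] using hasMean_of_tendsto (tendsto_const_nhds (x := (1 : ℂ)) (f := atTop (α := ℕ)))
  · have h1 : 0 < ‖α - 1‖ := norm_pos_iff.2 (sub_ne_zero.2 h)
    have h0 : Tendsto (fun N : ℕ => (N : ℝ)⁻¹ * (2 / ‖α - 1‖)) atTop (𝓝 0) := by
      simpa using (tendsto_inv_atTop_nhds_zero_nat (𝕜 := ℝ)).mul_const (2 / ‖α - 1‖)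
    refine squeeze_zero_norm (fun N => ?_) h0
    rw [norm_smul, geom_sum_eq h, norm_div, norm_inv, Real.norm_natCast]
    gcongr
    refine (norm_sub_le _ _).trans ?_
    rw [norm_pow, hα]
    norm_num

variable {S : Finset ℂ} {c : ℂ → ℂ}

lemma norm_trigSum_le (hS : ∀ α ∈ S, ‖α‖ = 1) (n : ℕ) : ‖trigSum S c n‖ ≤ ∑ α ∈ S, ‖c α‖ := by
  refine (norm_sum_le _ _).trans (sum_le_sum fun α hα => ?_)
  simp [hS α hα]

/-- A trigonometric sum without the constant frequency `1` has mean value zero. -/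
lemma hasMean_trigSum_zero (hS : ∀ α ∈ S, ‖α‖ = 1) (h1 : (1 : ℂ) ∉ S) :
    HasMean (trigSum S c) 0 := by
  have := HasMean.sum (s := S) fun α hα => (hasMean_pow (hS α hα)).const_mul (c α)
  rwa [sum_eq_zero fun α hα => by rw [if_neg (by rintro rfl; exact h1 hα), mul_zero]] at this

/-- Parseval's identity for trigonometric sums. -/
lemma hasMean_norm_sq_trigSum (hS : ∀ α ∈ S, ‖α‖ = 1) :
    HasMean (fun n => ‖trigSum S c n‖ ^ 2) (∑ α ∈ S, ‖c α‖ ^ 2) := by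
  have key : HasMean (fun n => ∑ α ∈ S, ∑ β ∈ S,
      (c α * star (c β)) * (α * star β) ^ n)
      (∑ α ∈ S, ∑ β ∈ S, (c α * star (c β)) * if α * star β = 1 then 1 else 0) :=
    HasMean.sum fun α hα => HasMean.sum fun β hβ =>
      (hasMean_pow (by simp [hS α hα, hS β hβ])).const_mul _
  convert key.re using 1
  · ext n
    have : ((‖trigSum S c n‖ ^ 2 : ℝ) : ℂ) = ∑ α ∈ S, ∑ β ∈ S,
      (c α * star (c β)) * (α * star β) ^ n := by
      push_cast
      rw [← Complex.mul_conj', trigSum, map_sum, sum_mul_sum]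
      refine sum_congr rfl fun α _ => sum_congr rfl fun β _ => ?_
      simp only [map_mul, map_pow, starRingEnd_apply]
      ring
    rw [← this, Complex.ofReal_re]
  · rw [Complex.re_sum]
    refine sum_congr rfl fun α hα => ?_
    have hαα : α * star α = 1 := by
      rw [← starRingEnd_apply, Complex.mul_conj', hS α hα]; simp
    rw [sum_eq_single_of_mem α hα]
    · rw [if_pos hαα, mul_one, ← starRingEnd_apply, Complex.mul_conj']
      norm_cast
    · intro β hβ hne
      rw [if_neg, mul_zero]
      intro h
      have hβ' : star β * β = 1 := by
        rw [← starRingEnd_apply, Complex.conj_mul', hS β hβ]; simp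
      apply hne
      calc β = (α * star β) * β := by rw [h, one_mul]
        _ = α * (star β * β) := mul_assoc _ _ _
        _ = α := by rw [hβ', mul_one]

/-- All moments of a trigonometric sum exist, since its powers are again such sums. -/
lemma exists_hasMean_trigSum_pow (hS : ∀ α ∈ S, ‖α‖ = 1) (k : ℕ) :
    ∃ a, HasMean (fun n => trigSum S c n ^ k) a := by
  have key := HasMean.sum (s := Fintype.piFinset fun _ : Fin k => S) fun p hp =>
    (hasMean_pow (α := ∏ i, p i) (by
      rw [norm_prod]
      exact prod_eq_one fun i _ => hS _ (Fintype.mem_piFinset.1 hp i))).const_mul (∏ i, c (p i))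
  refine ⟨_, key.congr_of_tendsto_sub (tendsto_const_nhds.congr fun n => ?_)⟩
  have := prod_univ_sum (fun _ : Fin k => S) (fun _ α => c α * α ^ n)
  rw [eq_comm, sub_eq_zero]
  simpa [trigSum, prod_mul_distrib, prod_pow] using this

/-! ### Small values of nondegenerate trigonometric sums -/

/-- The values of `g` are rarely small: the upper density of `{n | ‖g n‖ < ε}` tends to `0` with
`ε`. -/
def RarelySmall (g : ℕ → ℂ) : Prop :=
  ∀ δ > (0 : ℝ), ∃ ε > (0 : ℝ), ∀ᶠ N : ℕ in atTop, (#{n ∈ range N | ‖g n‖ < ε} : ℝ) ≤ δ * N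

lemma card_le_of_sparse {A : Finset ℕ} {N H : ℕ} (hA : A ⊆ range N)
    (hsp : ∀ n ∈ A, ∀ h ∈ Icc 1 H, n + h ∉ A) : #A ≤ N / (H + 1) + 1 := by
  have hinj : Set.InjOn (fun n => n / (H + 1)) (A : Set ℕ) := by
    have key : ∀ m ∈ A, ∀ n ∈ A, m / (H + 1) = n / (H + 1) → m ≤ n → m = n := by
      intro m hm n hn hmn hle
      by_contra hne
      refine hsp m hm (n - m) (mem_Icc.2 ⟨by omega, ?_⟩) (by rwa [Nat.add_sub_cancel' hle])
      have h1 := Nat.div_add_mod m (H + 1)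
      have h2 := Nat.div_add_mod n (H + 1)
      have h3 := Nat.mod_lt m (Nat.succ_pos H)
      have h4 := Nat.mod_lt n (Nat.succ_pos H)
      rw [hmn] at h1
      simp only [Nat.succ_eq_add_one] at h3 h4
      omega
    intro m hm n hn hmn
    rcases le_total m n with h | h
    · exact key m hm n hn hmn h
    · exact (key n hn m hm hmn.symm h).symm
  rw [← card_image_of_injOn hinj]
  calc #(A.image fun n => n / (H + 1)) ≤ #(range (N / (H + 1) + 1)) := by
        refine card_le_card (image_subset_iff.2 fun n hn => ?_)
        have := mem_range.1 (hA hn)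
        exact mem_range.2 (Nat.lt_succ_of_le (Nat.div_le_div_right this.le))
    _ = _ := card_range _

/-- A differencing criterion. If `g` were small on a set of positive upper density, many pairs of
elements of this set would be at a bounded distance `h`, so that the twisted difference
`g (n + h) - β ^ h * g n` would be small on a set of positive upper density, too. -/
lemma RarelySmall.of_differences {g : ℕ → ℂ} {β : ℂ} (hβ : ‖β‖ = 1)
    (h : ∀ h ≥ 1, RarelySmall fun n => g (n + h) - β ^ h * g n) : RarelySmall g := by
  intro δ hδ
  obtain ⟨H, hH⟩ := exists_nat_gt (3 / δ)
  have hH0 : (0 : ℝ) < H := lt_trans (by positivity) hH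
  have hη : 0 < δ / (3 * H) := by positivity
  have h' : ∀ k : ℕ, ∃ ε > (0 : ℝ), k ≥ 1 → ∀ᶠ N : ℕ in atTop,
      (#{n ∈ range N | ‖g (n + k) - β ^ k * g n‖ < ε} : ℝ) ≤ δ / (3 * H) * N := by
    intro k
    by_cases hk : k ≥ 1
    · obtain ⟨ε, hε, he⟩ := h k hk _ hη
      exact ⟨ε, hε, fun _ => he⟩
    · exact ⟨1, one_pos, fun h => absurd h hk⟩
  choose e he hev using h'
  have hne : (Icc 1 H).Nonempty := nonempty_Icc.2 (by exact_mod_cast hH0)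
  set ε := (Icc 1 H).inf' hne e with hεdef
  have hε : 0 < ε := (lt_inf'_iff hne).2 fun k _ => he k
  refine ⟨ε / 2, half_pos hε, ?_⟩
  have hall : ∀ᶠ N : ℕ in atTop, ∀ k ∈ Icc 1 H,
      (#{n ∈ range N | ‖g (n + k) - β ^ k * g n‖ < e k} : ℝ) ≤ δ / (3 * H) * N :=
    (eventually_all_finset _).2 fun k hk => hev k (mem_Icc.1 hk).1
  have hlarge : ∀ᶠ N : ℕ in atTop, 3 / δ ≤ N :=
    tendsto_natCast_atTop_atTop.eventually_ge_atTop _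
  filter_upwards [hall, hlarge] with N hN hN3
  set A := {n ∈ range N | ‖g n‖ < ε / 2} with hA
  -- the elements of `A` with another element of `A` at distance at most `H` to their right
  -- lie in the union below; the others are sparse
  set U := (Icc 1 H).biUnion fun k => {n ∈ range N | ‖g (n + k) - β ^ k * g n‖ < e k} with hU
  have hU_card : (#U : ℝ) ≤ δ / 3 * N := by
    calc (#U : ℝ) ≤ ∑ k ∈ Icc 1 H, (#{n ∈ range N | ‖g (n + k) - β ^ k * g n‖ < e k} : ℝ) := by
          exact_mod_cast card_biUnion_le
      _ ≤ ∑ k ∈ Icc 1 H, δ / (3 * H) * N := sum_le_sum hN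
      _ = δ / 3 * N := by
          rw [sum_const, Nat.card_Icc, nsmul_eq_mul]
          simp only [Nat.add_sub_cancel]
          field_simp
  have hsparse : #(A \ U) ≤ N / (H + 1) + 1 := by
    refine card_le_of_sparse (sdiff_subset.trans (filter_subset _ _)) fun n hn k hk hnk => ?_
    rw [Finset.mem_sdiff] at hn hnk
    refine hn.2 (mem_biUnion.2 ⟨k, hk, mem_filter.2 ⟨(mem_filter.1 hn.1).1, ?_⟩⟩)
    have h1 := (mem_filter.1 hn.1).2
    have h2 := (mem_filter.1 hnk.1).2
    calc ‖g (n + k) - β ^ k * g n‖ ≤ ‖g (n + k)‖ + ‖β ^ k * g n‖ := norm_sub_le _ _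
      _ = ‖g (n + k)‖ + ‖g n‖ := by rw [norm_mul, norm_pow, hβ, one_pow, one_mul]
      _ < ε := by linarith
      _ ≤ e k := inf'_le _ hk
  have hsparse' : (#(A \ U) : ℝ) ≤ δ / 3 * N + δ / 3 * N := by
    calc (#(A \ U) : ℝ) ≤ ((N / (H + 1) + 1 : ℕ) : ℝ) := by exact_mod_cast hsparse
      _ ≤ (N : ℝ) / ((H + 1 : ℕ) : ℝ) + 1 := by
          push_cast
          gcongr
          exact_mod_cast Nat.cast_div_le (α := ℝ) (m := N) (n := H + 1)
      _ ≤ δ / 3 * N + δ / 3 * N := by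
          apply add_le_add
          · rw [div_le_iff₀ (by positivity)]
            push_cast
            rw [div_lt_iff₀ hδ] at hH
            have : (0 : ℝ) ≤ N := by positivity
            nlinarith
          · rw [div_le_iff₀ hδ] at hN3
            linarith
  calc (#A : ℝ) ≤ (#(A \ U) : ℝ) + #U := by exact_mod_cast (card_le_card_sdiff_add_card)
    _ ≤ δ * N := by linarith

/-- If no quotient of distinct frequencies is a root of unity, twisted differencing removes one
frequency and keeps the other ones; induction on the number of frequencies applies. -/
lemma rarelySmall_trigSum {S : Finset ℂ} (hne : S.Nonempty) (hS : ∀ α ∈ S, ‖α‖ = 1)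
    (hnd : ∀ α ∈ S, ∀ β ∈ S, ∀ h ≥ 1, α ^ h = β ^ h → α = β) :
    ∀ c : ℂ → ℂ, (∀ α ∈ S, c α ≠ 0) → RarelySmall (trigSum S c) := by
  induction hne using Finset.Nonempty.cons_induction with
  | singleton β =>
    intro c hc δ hδ
    have hβ := hc β (mem_singleton_self β)
    refine ⟨‖c β‖, norm_pos_iff.2 hβ, Eventually.of_forall fun N => ?_⟩
    have : {n ∈ range N | ‖trigSum {β} c n‖ < ‖c β‖} = ∅ := by
      refine filter_false_of_mem fun n _ => ?_
      simp [trigSum, hS β (mem_singleton_self β)]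
    rw [this]
    simp only [card_empty, Nat.cast_zero]
    positivity
  | cons β T hβ hT ih =>
    intro c hc
    refine RarelySmall.of_differences (hS β (mem_cons_self _ _)) fun h hh => ?_
    have hsub : ∀ α ∈ T, α ∈ cons β T hβ := fun α hα => mem_cons_of_mem hα
    have := ih (fun α hα => hS α (hsub α hα))
      (fun α hα γ hγ => hnd α (hsub α hα) γ (hsub γ hγ)) (fun α => c α * (α ^ h - β ^ h))
      fun α hα => mul_ne_zero (hc α (hsub α hα)) (sub_ne_zero.2 fun heq =>
        hβ (hnd α (hsub α hα) β (mem_cons_self _ _) h hh heq ▸ hα))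
    convert this using 2 with n
    rw [trigSum, trigSum, trigSum, sum_cons, sum_cons, mul_add, mul_sum, add_sub_add_comm,
      ← sum_sub_distrib]
    have : c β * β ^ (n + h) - β ^ h * (c β * β ^ n) = 0 := by ring
    rw [this, zero_add]
    exact sum_congr rfl fun α _ => by ring

/-! ### Signs of sequences asymptotic to trigonometric sums -/

/-- The indicator sequence of positivity of `F`. -/
noncomputable def posInd (F : ℕ → ℝ) (n : ℕ) : ℝ := if 0 < F n then 1 else 0

section Asymptotic

variable {F : ℕ → ℝ} {S : Finset ℂ} {c : ℂ → ℂ}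

lemma exists_abs_le_of_tendsto_sub (hS : ∀ α ∈ S, ‖α‖ = 1)
    (hF : Tendsto (fun n => (F n : ℂ) - trigSum S c n) atTop (𝓝 0)) :
    ∃ C > 0, ∀ n, |F n| ≤ C := by
  obtain ⟨R, hR⟩ := (Metric.isBounded_range_of_tendsto _ hF).exists_norm_le
  have hR0 : 0 ≤ R := (norm_nonneg _).trans (hR _ ⟨0, rfl⟩)
  refine ⟨R + ∑ α ∈ S, ‖c α‖ + 1,
    add_pos_of_nonneg_of_pos (add_nonneg hR0 (sum_nonneg fun _ _ => norm_nonneg _)) one_pos,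
    fun n => ?_⟩
  have h1 := hR _ ⟨n, rfl⟩
  have h2 := norm_trigSum_le (c := c) hS n
  have h3 := norm_add_le ((F n : ℂ) - trigSum S c n) (trigSum S c n)
  rw [sub_add_cancel, Complex.norm_real, Real.norm_eq_abs] at h3
  simp only at h1
  linarith

lemma tendsto_pow_sub_trigSum_pow (hS : ∀ α ∈ S, ‖α‖ = 1)
    (hF : Tendsto (fun n => (F n : ℂ) - trigSum S c n) atTop (𝓝 0)) (k : ℕ) :
    Tendsto (fun n => ((F n ^ k : ℝ) : ℂ) - trigSum S c n ^ k) atTop (𝓝 0) := by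
  obtain ⟨C, hC, hFC⟩ := exists_abs_le_of_tendsto_sub hS hF
  induction k with
  | zero => simp
  | succ k ih =>
    have h1 : Tendsto (fun n => ((F n : ℂ) - trigSum S c n) * ((F n ^ k : ℝ) : ℂ)) atTop (𝓝 0) := by
      refine NormedField.tendsto_zero_smul_of_tendsto_zero_of_bounded hF
        (isBoundedUnder_of ⟨C ^ k, fun n => ?_⟩)
      simp only [Function.comp_apply, Complex.norm_real, norm_pow, Real.norm_eq_abs]
      exact pow_le_pow_left₀ (abs_nonneg _) (hFC n) k
    have h2 : Tendsto (fun n => (((F n ^ k : ℝ) : ℂ) - trigSum S c n ^ k) * trigSum S c n)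
        atTop (𝓝 0) := by
      refine NormedField.tendsto_zero_smul_of_tendsto_zero_of_bounded ih
        (isBoundedUnder_of ⟨_, fun n => norm_trigSum_le hS n⟩)
    have := h1.add h2
    rw [add_zero] at this
    refine this.congr fun n => ?_
    push_cast
    ring

lemma exists_hasMean_pow (hS : ∀ α ∈ S, ‖α‖ = 1)
    (hF : Tendsto (fun n => (F n : ℂ) - trigSum S c n) atTop (𝓝 0)) (k : ℕ) :
    ∃ a, HasMean (fun n => F n ^ k) a := by
  obtain ⟨a, ha⟩ := exists_hasMean_trigSum_pow (c := c) hS k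
  refine ⟨a.re, ?_⟩
  have := (ha.congr_of_tendsto_sub (tendsto_pow_sub_trigSum_pow hS hF k)).re
  simpa only [Complex.ofReal_re] using this

/-- If `F` is asymptotic to a nondegenerate trigonometric sum, the set `{n | 0 < F n}` has a
density: its indicator is the composition of `F` with a continuous function up to an error that
is supported on small values of `F`. -/
lemma exists_hasMean_posInd (hne : S.Nonempty) (hS : ∀ α ∈ S, ‖α‖ = 1) (hc : ∀ α ∈ S, c α ≠ 0)
    (hnd : ∀ α ∈ S, ∀ β ∈ S, ∀ h ≥ 1, α ^ h = β ^ h → α = β)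
    (hF : Tendsto (fun n => (F n : ℂ) - trigSum S c n) atTop (𝓝 0)) :
    ∃ d, HasMean (posInd F) d := by
  obtain ⟨C, hC, hFC⟩ := exists_abs_le_of_tendsto_sub hS hF
  apply exists_tendsto_of_approx
  intro δ hδ
  obtain ⟨ε, hε, hsmall⟩ := rarelySmall_trigSum hne hS hnd c hc (δ / 2) (half_pos hδ)
  -- a continuous function that agrees with the indicator of positivity off `(-ε / 2, ε / 2)`
  set φ : ℝ → ℝ := fun x => max 0 (min 1 (x / (ε / 2))) with hφ
  have hφc : Continuous φ := by fun_prop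
  obtain ⟨a, ha⟩ := exists_hasMean_comp hFC (exists_hasMean_pow hS hF) hφc
  refine ⟨_, a, ha, ?_⟩
  obtain ⟨N₀, hN₀⟩ := eventually_atTop.1 ((Metric.tendsto_nhds.1 hF) (ε / 2) (half_pos hε))
  have hlarge : ∀ᶠ N : ℕ in atTop, 2 * N₀ / δ ≤ N :=
    tendsto_natCast_atTop_atTop.eventually_ge_atTop _
  filter_upwards [hsmall, hlarge, eventually_gt_atTop 0] with N hN hN' hN0
  have hpt : ∀ n, |posInd F n - φ (F n)| ≤
      (if n < N₀ then 1 else 0) + (if ‖trigSum S c n‖ < ε then 1 else 0) := by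
    intro n
    have hφ0 : 0 ≤ φ (F n) := le_max_left _ _
    have hφ1 : φ (F n) ≤ 1 := max_le zero_le_one (min_le_left _ _)
    have hle1 : |posInd F n - φ (F n)| ≤ 1 := by
      unfold posInd
      rw [abs_le]
      split_ifs <;> constructor <;> linarith
    by_cases h1 : n < N₀
    · rw [if_pos h1]
      refine hle1.trans ?_
      split_ifs <;> norm_num
    by_cases h2 : ‖trigSum S c n‖ < ε
    · simpa [h1, h2] using hle1
    rw [if_neg h1, if_neg h2, add_zero]
    have h3 := hN₀ n (not_lt.1 h1)
    rw [dist_zero_right] at h3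
    have h4 := norm_sub_norm_le (trigSum S c n) (F n : ℂ)
    rw [norm_sub_rev, Complex.norm_real, Real.norm_eq_abs] at h4
    have h5 : ε / 2 ≤ |F n| := by linarith
    rcases le_total 0 (F n) with hp | hp
    · rw [abs_of_nonneg hp] at h5
      have : 1 ≤ F n / (ε / 2) := (one_le_div (half_pos hε)).2 h5
      simp [posInd, hφ, this, (half_pos hε).trans_le h5]
    · have : F n / (ε / 2) ≤ 0 := div_nonpos_of_nonpos_of_nonneg hp (half_pos hε).le
      simp only [posInd, hφ, not_lt.2 hp, if_false]
      rw [max_eq_left ((min_le_right _ _).trans this)]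
      simp
  refine (abs_avg_sub_le N hpt).trans ?_
  rw [sum_add_distrib, sum_boole, sum_boole, inv_mul_le_iff₀ (by positivity)]
  have h6 : (#{n ∈ range N | n < N₀} : ℝ) ≤ N₀ := by
    have : #{n ∈ range N | n < N₀} ≤ #(range N₀) :=
      card_le_card fun n hn => mem_range.2 (mem_filter.1 hn).2
    rw [card_range] at this
    exact_mod_cast this
  rw [div_le_iff₀ hδ] at hN'
  linarith

/-- If `F` is asymptotic to a trigonometric sum without the frequency `1`, then `F` has mean value
zero, and its square has positive mean value. So `F` is positive with positive frequency. -/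
lemma pos_of_hasMean_posInd (hne : S.Nonempty) (hS : ∀ α ∈ S, ‖α‖ = 1) (hc : ∀ α ∈ S, c α ≠ 0)
    (h1 : (1 : ℂ) ∉ S) (hF : Tendsto (fun n => (F n : ℂ) - trigSum S c n) atTop (𝓝 0)) {d : ℝ}
    (hd : HasMean (posInd F) d) : 0 < d := by
  obtain ⟨C, hC, hFC⟩ := exists_abs_le_of_tendsto_sub hS hF
  have hmean : HasMean F 0 := by
    simpa using ((hasMean_trigSum_zero hS h1).congr_of_tendsto_sub hF).re
  have hsq : HasMean (fun n => F n ^ 2) (∑ α ∈ S, ‖c α‖ ^ 2) := by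
    refine (hasMean_norm_sq_trigSum hS).congr_of_tendsto_sub ?_
    have h2 := (tendsto_pow_sub_trigSum_pow hS hF 2).norm
    rw [norm_zero] at h2
    refine squeeze_zero_norm (fun n => ?_) h2
    have := abs_norm_sub_norm_le ((F n ^ 2 : ℝ) : ℂ) (trigSum S c n ^ 2)
    simpa only [Complex.norm_real, norm_pow, Real.norm_eq_abs, sq_abs] using this
  have hpos : 0 < ∑ α ∈ S, ‖c α‖ ^ 2 :=
    sum_pos (fun α hα => by have := norm_pos_iff.2 (hc α hα); positivity) hne
  -- `F n ^ 2 + C * F n ≤ 2 * C ^ 2` if `0 < F n`, and `F n ^ 2 + C * F n ≤ 0` otherwise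
  have hle : ∀ n, F n ^ 2 + C * F n ≤ 2 * C ^ 2 * posInd F n := by
    intro n
    have := abs_le.1 (hFC n)
    unfold posInd
    split_ifs with h <;> nlinarith
  have hlim := le_of_tendsto_of_tendsto' (hsq.add (hmean.const_mul_real C))
    (hd.const_mul_real (2 * C ^ 2)) fun N =>
      smul_le_smul_of_nonneg_left (sum_le_sum fun n _ => hle n) (by positivity)
  rw [mul_zero, add_zero] at hlim
  exact pos_of_mul_pos_right (hpos.trans_le hlim) (by positivity)

end Asymptotic

/-! ### Leading terms of power sums -/

/-- The generalized power sum `∑ γ, P γ (n) * γ ^ n`, as a sequence in `n`. -/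
noncomputable def powerSum (P : ℂ →₀ Polynomial ℂ) (n : ℕ) : ℂ :=
  P.sum fun γ p => p.eval (n : ℂ) * γ ^ n

lemma tendsto_eval_mul_pow (p : Polynomial ℂ) {z : ℂ} (hz : ‖z‖ < 1) :
    Tendsto (fun n : ℕ => p.eval (n : ℂ) * z ^ n) atTop (𝓝 0) := by
  have h : ∀ i ∈ range (p.natDegree + 1),
      Tendsto (fun n : ℕ => p.coeff i * ((n : ℂ) ^ i * z ^ n)) atTop (𝓝 0) := by
    intro i _
    have h0 := tendsto_pow_const_mul_const_pow_of_lt_one i (norm_nonneg z) hz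
    have h1 : Tendsto (fun n : ℕ => (n : ℂ) ^ i * z ^ n) atTop (𝓝 0) :=
      squeeze_zero_norm (fun n => by simp) h0
    simpa using h1.const_mul (p.coeff i)
  have := tendsto_finsetSum _ h
  rw [sum_const_zero] at this
  refine this.congr fun n => ?_
  rw [Polynomial.eval_eq_sum_range, sum_mul]
  exact sum_congr rfl fun i _ => by ring

lemma tendsto_eval_div_pow (p : Polynomial ℂ) {D : ℕ} (hD : p.natDegree ≤ D) :
    Tendsto (fun n : ℕ => p.eval (n : ℂ) / (n : ℂ) ^ D) atTop (𝓝 (p.coeff D)) := by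
  have h : ∀ i ∈ range (D + 1), Tendsto (fun n : ℕ => p.coeff i * ((n : ℂ) ^ i / (n : ℂ) ^ D)) atTop
      (𝓝 (p.coeff i * if i = D then 1 else 0)) := by
    intro i hi
    refine Tendsto.const_mul _ ?_
    split_ifs with hiD
    · subst hiD
      refine tendsto_const_nhds.congr' ?_
      filter_upwards [eventually_gt_atTop 0] with n hn
      rw [div_self]
      have : (n : ℂ) ≠ 0 := by exact_mod_cast hn.ne'
      positivity
    · have hlt : i < D := lt_of_le_of_ne (Nat.lt_succ_iff.1 (mem_range.1 hi)) hiD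
      have h0 : Tendsto (fun n : ℕ => ((n : ℂ)⁻¹) ^ (D - i)) atTop (𝓝 0) := by
        simpa [zero_pow (Nat.sub_pos_of_lt hlt).ne'] using
          (tendsto_inv_atTop_nhds_zero_nat (𝕜 := ℂ)).pow (D - i)
      refine h0.congr' ?_
      filter_upwards [eventually_gt_atTop 0] with n hn
      have hn' : (n : ℂ) ≠ 0 := by exact_mod_cast hn.ne'
      rw [inv_pow, ← one_div, div_eq_div_iff (pow_ne_zero _ hn') (pow_ne_zero _ hn'), one_mul,
        ← pow_add, Nat.add_sub_cancel' hlt.le]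
  have := tendsto_finsetSum _ h
  simp only [mul_ite, mul_one, mul_zero, sum_ite_eq', mem_range, Nat.lt_succ_self, if_true] at this
  refine this.congr fun n => ?_
  rw [Polynomial.eval_eq_sum_range' (Nat.lt_succ_of_le hD), sum_div]
  exact sum_congr rfl fun i _ => by ring

/-- A nonzero power sum is, after division by `n ^ D * ρ ^ n`, asymptotic to a nonzero
trigonometric sum. Here `ρ` is the largest modulus of a root, and `D` is the largest degree of a
coefficient of a root of modulus `ρ`. -/
lemma exists_leading_trigSum {P : ℂ →₀ Polynomial ℂ} (hP : P ≠ 0) (h0 : P 0 = 0) :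
    ∃ (ρ : ℝ) (D : ℕ) (S : Finset ℂ) (c : ℂ → ℂ), 0 < ρ ∧ S.Nonempty ∧ (∀ α ∈ S, ‖α‖ = 1) ∧
      (∀ α ∈ S, c α ≠ 0) ∧ (∀ α ∈ S, (ρ : ℂ) * α ∈ P.support) ∧ (∀ γ ∈ P.support, ‖γ‖ ≤ ρ) ∧
      Tendsto (fun n : ℕ => powerSum P n / ((n : ℂ) ^ D * (ρ : ℂ) ^ n) - trigSum S c n)
        atTop (𝓝 0) := by
  classical
  obtain ⟨γ₀, hγ₀, hmax⟩ := exists_max_image P.support (‖·‖) (Finsupp.support_nonempty_iff.2 hP)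
  set ρ := ‖γ₀‖ with hρ
  have hρ0 : 0 < ρ := norm_pos_iff.2 (by rintro rfl; exact Finsupp.mem_support_iff.1 hγ₀ h0)
  have hρC : (ρ : ℂ) ≠ 0 := by exact_mod_cast hρ0.ne'
  obtain ⟨γ₁, hγ₁, hdeg⟩ := exists_max_image {γ ∈ P.support | ‖γ‖ = ρ} (fun γ => (P γ).natDegree)
    ⟨γ₀, mem_filter.2 ⟨hγ₀, rfl⟩⟩
  set D := (P γ₁).natDegree with hD
  set T := {γ ∈ P.support | ‖γ‖ = ρ ∧ (P γ).natDegree = D} with hT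
  have hinj : Set.InjOn (fun γ : ℂ => γ / ρ) (T : Set ℂ) := fun a _ b _ hab => by
    simpa [div_left_inj' hρC] using hab
  refine ⟨ρ, D, T.image (fun γ => γ / ρ), fun α => (P (ρ * α)).coeff D, hρ0,
    ⟨γ₁ / ρ, mem_image_of_mem _ ?_⟩, ?_, ?_, ?_, hmax, ?_⟩
  · rw [mem_filter] at hγ₁
    exact mem_filter.2 ⟨hγ₁.1, hγ₁.2, rfl⟩
  · simp only [forall_mem_image]
    intro γ hγ
    rw [norm_div, (mem_filter.1 hγ).2.1, Complex.norm_real, Real.norm_eq_abs, abs_of_pos hρ0,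
      div_self hρ0.ne']
  · simp only [forall_mem_image]
    intro γ hγ
    rw [mul_div_cancel₀ _ hρC, ← (mem_filter.1 hγ).2.2]
    exact Polynomial.leadingCoeff_ne_zero.2 (Finsupp.mem_support_iff.1 (mem_filter.1 hγ).1)
  · simp only [forall_mem_image]
    intro γ hγ
    rw [mul_div_cancel₀ _ hρC]
    exact (mem_filter.1 hγ).1
  have hterm : ∀ γ ∈ P.support, Tendsto (fun n : ℕ =>
      (P γ).eval (n : ℂ) * γ ^ n / ((n : ℂ) ^ D * (ρ : ℂ) ^ n) -
        if ‖γ‖ = ρ ∧ (P γ).natDegree = D then (P γ).coeff D * (γ / ρ) ^ n else 0) atTop (𝓝 0) := by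
    intro γ hγ
    by_cases hγρ : ‖γ‖ = ρ
    · have hle : (P γ).natDegree ≤ D := hdeg γ (mem_filter.2 ⟨hγ, hγρ⟩)
      have h1 : Tendsto (fun n : ℕ => (P γ).eval (n : ℂ) / (n : ℂ) ^ D - (P γ).coeff D) atTop
          (𝓝 0) := by
        simpa using (tendsto_eval_div_pow (P γ) hle).sub_const ((P γ).coeff D)
      have h2 := NormedField.tendsto_zero_smul_of_tendsto_zero_of_bounded h1
        (isBoundedUnder_of (f := atTop) (u := norm ∘ fun n : ℕ => (γ / ρ) ^ n) (r := (· ≤ ·))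
          ⟨1, fun n => by simp [hγρ, abs_of_pos hρ0, div_self hρ0.ne']⟩)
      refine h2.congr fun n => ?_
      have h3 : (if ‖γ‖ = ρ ∧ (P γ).natDegree = D then (P γ).coeff D * (γ / ρ) ^ n else 0) =
          (P γ).coeff D * (γ / ρ) ^ n := by
        split_ifs with h
        · rfl
        · rw [Polynomial.coeff_eq_zero_of_natDegree_lt
            (lt_of_le_of_ne hle fun he => h ⟨hγρ, he⟩), zero_mul]
      rw [h3, Pi.smul_apply', smul_eq_mul, sub_mul, div_pow, div_mul_div_comm]
    · have hlt : ‖γ / ρ‖ < 1 := by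
        rw [norm_div, Complex.norm_real, Real.norm_eq_abs, abs_of_pos hρ0, div_lt_one hρ0]
        exact lt_of_le_of_ne (hmax γ hγ) hγρ
      refine squeeze_zero_norm' ?_ (tendsto_norm_zero.comp (tendsto_eval_mul_pow (P γ) hlt))
      filter_upwards [eventually_ge_atTop 1] with n hn
      rw [if_neg fun h => hγρ h.1, sub_zero, mul_comm ((n : ℂ) ^ D), ← div_div, mul_div_assoc,
        ← div_pow, norm_div, norm_pow (n : ℂ), Complex.norm_natCast]
      exact div_le_self (norm_nonneg _) (one_le_pow₀ (by exact_mod_cast hn))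
  have hsum := tendsto_finsetSum _ hterm
  rw [sum_const_zero] at hsum
  refine hsum.congr fun n => ?_
  rw [sum_sub_distrib, ← sum_filter, ← sum_div, powerSum, Finsupp.sum, trigSum,
    sum_image hinj]
  simp only [mul_div_cancel₀ _ hρC]
  rfl

/-- A nonzero power sum without the root `0` does not vanish eventually. -/
lemma eq_zero_of_eventually_powerSum_eq_zero {P : ℂ →₀ Polynomial ℂ} (h0 : P 0 = 0)
    (h : ∀ᶠ n in atTop, powerSum P n = 0) : P = 0 := by
  by_contra hP
  obtain ⟨ρ, D, S, c, -, hne, hS, hc, -, -, hlim⟩ := exists_leading_trigSum hP h0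
  have h1 : Tendsto (trigSum S c) atTop (𝓝 0) := by
    rw [← tendsto_neg_iff, neg_zero]
    refine hlim.congr' ?_
    filter_upwards [h] with n hn
    rw [hn, zero_div, zero_sub]
  have h2 := (h1.norm.pow 2)
  rw [norm_zero, zero_pow two_ne_zero] at h2
  have h3 := tendsto_nhds_unique (hasMean_norm_sq_trigSum (c := c) hS) (hasMean_of_tendsto h2)
  have hpos : 0 < ∑ α ∈ S, ‖c α‖ ^ 2 :=
    sum_pos (fun α hα => by have := norm_pos_iff.2 (hc α hα); positivity) hne
  exact hpos.ne' h3

/-! ### Arithmetic progressions -/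

/-- The coefficients of the power sum `m ↦ powerSum P (q * m + r)`, whose roots are `q`-th powers
of roots of `P`. -/
noncomputable def decimate (P : ℂ →₀ Polynomial ℂ) (q r : ℕ) : ℂ →₀ Polynomial ℂ :=
  P.sum fun γ p => Finsupp.single (γ ^ q)
    (Polynomial.C (γ ^ r) * p.comp (Polynomial.C (q : ℂ) * Polynomial.X + Polynomial.C (r : ℂ)))

lemma powerSum_decimate (P : ℂ →₀ Polynomial ℂ) (q r m : ℕ) :
    powerSum (decimate P q r) m = powerSum P (q * m + r) := by
  rw [powerSum, decimate, Finsupp.sum_sum_index (by simp) (by intros; simp [add_mul]), powerSum]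
  refine Finsupp.sum_congr fun γ _ => ?_
  rw [Finsupp.sum_single_index (by simp)]
  simp only [Polynomial.eval_mul, Polynomial.eval_C, Polynomial.eval_comp, Polynomial.eval_add,
    Polynomial.eval_X, Nat.cast_add, Nat.cast_mul]
  ring

lemma exists_of_mem_support_decimate {P : ℂ →₀ Polynomial ℂ} {q r : ℕ} {δ : ℂ}
    (h : δ ∈ (decimate P q r).support) : ∃ γ ∈ P.support, γ ^ q = δ := by
  classical
  have := Finsupp.support_sum h
  rw [mem_biUnion] at this
  obtain ⟨γ, hγ, hδ⟩ := this
  exact ⟨γ, hγ, (mem_singleton.1 (Finsupp.support_single_subset hδ)).symm⟩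

/-- For a suitable `q`, no quotient of distinct `q`-th powers of elements of `T` is a root of
unity. -/
lemma exists_pow_nondegenerate (T : Finset ℂ) (hT : 0 ∉ T) :
    ∃ q > 0, ∀ γ ∈ T, ∀ δ ∈ T, ∀ h ≥ 1, (γ ^ q) ^ h = (δ ^ q) ^ h → γ ^ q = δ ^ q := by
  -- `orderOf` is `0` at elements that are not roots of unity
  set q := ∏ x ∈ T ×ˢ T, max 1 (orderOf (x.1 / x.2)) with hq
  have hq0 : 0 < q := prod_pos fun x _ => lt_max_of_lt_left one_pos
  refine ⟨q, hq0, fun γ hγ δ hδ h hh heq => ?_⟩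
  have hδ0 : δ ≠ 0 := by rintro rfl; exact hT hδ
  have h1 : (γ / δ) ^ (q * h) = 1 := by
    rw [div_pow, pow_mul, pow_mul, heq, div_self (pow_ne_zero _ (pow_ne_zero _ hδ0))]
  have h2 : 1 ≤ orderOf (γ / δ) :=
    Nat.pos_of_ne_zero fun hz => orderOf_eq_zero_iff'.1 hz (q * h) (Nat.mul_pos hq0 hh) h1
  have h3 : orderOf (γ / δ) ∣ q := by
    have := dvd_prod_of_mem (fun x : ℂ × ℂ => max 1 (orderOf (x.1 / x.2)))
      (mem_product.2 ⟨hγ, hδ⟩ : (γ, δ) ∈ T ×ˢ T)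
    simpa only [max_eq_right h2] using this
  have h4 := orderOf_dvd_iff_pow_eq_one.1 h3
  rwa [div_pow, div_eq_one_iff_eq (pow_ne_zero _ hδ0)] at h4

/-- A bounded sequence has a mean value if it has one along each residue class modulo `q`. -/
lemma exists_hasMean_of_residues {u : ℕ → ℝ} {C : ℝ} (hu : ∀ n, |u n| ≤ C) {q : ℕ} (hq : 0 < q)
    (h : ∀ r < q, ∃ a, HasMean (fun m => u (q * m + r)) a) : ∃ a, HasMean u a := by
  have hC : 0 ≤ C := (abs_nonneg _).trans (hu 0)
  choose! a ha using h
  have hblock : ∀ M : ℕ, ∑ n ∈ range (q * M), u n = ∑ r ∈ range q, ∑ m ∈ range M, u (q * m + r) := by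
    intro M
    induction M with
    | zero => simp
    | succ M ih =>
      simp only [sum_range_succ, sum_add_distrib]
      rw [Nat.mul_succ, sum_range_add, ih]
  have hdiv : Tendsto (fun N : ℕ => N / q) atTop atTop := Nat.tendsto_div_const_atTop hq.ne'
  have hratio : Tendsto (fun N : ℕ => ((N / q : ℕ) : ℝ) / N) atTop (𝓝 ((q : ℝ)⁻¹)) := by
    have := (tendsto_nat_floor_mul_div_atTop (R := ℝ) (a := (q : ℝ)⁻¹) (by positivity)).comp
      tendsto_natCast_atTop_atTop
    refine this.congr fun N => ?_
    simp only [Function.comp_apply]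
    rw [inv_mul_eq_div, Nat.floor_div_eq_div]
  have hmain : Tendsto (fun N : ℕ => ((N / q : ℕ) : ℝ) / N * ∑ r ∈ range q,
      (((N / q : ℕ) : ℝ)⁻¹ • ∑ m ∈ range (N / q), u (q * m + r))) atTop
      (𝓝 ((q : ℝ)⁻¹ * ∑ r ∈ range q, a r)) :=
    hratio.mul (tendsto_finsetSum _ fun r hr => (ha r (mem_range.1 hr)).comp hdiv)
  have hrest : Tendsto (fun N : ℕ => (N : ℝ)⁻¹ *
      ∑ i ∈ range (N % q), u (q * (N / q) + i)) atTop (𝓝 0) := by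
    have h0 : Tendsto (fun N : ℕ => (N : ℝ)⁻¹ * (q * C)) atTop (𝓝 0) := by
      simpa using (tendsto_inv_atTop_nhds_zero_nat (𝕜 := ℝ)).mul_const (q * C)
    refine squeeze_zero_norm (fun N => ?_) h0
    rw [norm_mul, norm_inv, Real.norm_natCast]
    gcongr
    refine (norm_sum_le_of_le _ fun i _ => hu _).trans ?_
    rw [sum_const, card_range, nsmul_eq_mul]
    gcongr
    exact_mod_cast (Nat.mod_lt N hq).le
  refine ⟨_, (hmain.add hrest).congr' ?_⟩
  filter_upwards [eventually_ge_atTop q] with N hN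
  have h1 : ((N / q : ℕ) : ℝ) ≠ 0 := by exact_mod_cast (Nat.div_pos hN hq).ne'
  have h2 : ∑ n ∈ range N, u n = ∑ n ∈ range (q * (N / q)), u n +
      ∑ i ∈ range (N % q), u (q * (N / q) + i) := by
    rw [← sum_range_add, Nat.div_add_mod]
  rw [h2, hblock]
  simp only [smul_eq_mul, ← mul_sum]
  field_simp

/-! ### Signs of real power sums -/

/-- A real sequence given by a nonzero power sum is, up to a positive factor, asymptotic to a
trigonometric sum. -/
lemma exists_normalization {f : ℕ → ℝ} {P : ℂ →₀ Polynomial ℂ} (hP : P ≠ 0) (h0 : P 0 = 0)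
    (hf : ∀ᶠ n in atTop, (f n : ℂ) = powerSum P n) :
    ∃ (ρ : ℝ) (S : Finset ℂ) (c : ℂ → ℂ) (w : ℕ → ℝ), 0 < ρ ∧ S.Nonempty ∧ (∀ α ∈ S, ‖α‖ = 1) ∧
      (∀ α ∈ S, c α ≠ 0) ∧ (∀ α ∈ S, (ρ : ℂ) * α ∈ P.support) ∧ (∀ γ ∈ P.support, ‖γ‖ ≤ ρ) ∧
      (∀ᶠ n in atTop, 0 < w n) ∧
      Tendsto (fun n : ℕ => ((f n / w n : ℝ) : ℂ) - trigSum S c n) atTop (𝓝 0) := by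
  obtain ⟨ρ, D, S, c, hρ, hne, hS, hc, hsupp, hle, hlim⟩ := exists_leading_trigSum hP h0
  refine ⟨ρ, S, c, fun n => (n : ℝ) ^ D * ρ ^ n, hρ, hne, hS, hc, hsupp, hle, ?_, ?_⟩
  · filter_upwards [eventually_gt_atTop 0] with n hn
    positivity
  · refine hlim.congr' ?_
    filter_upwards [hf] with n hn
    rw [← hn]
    push_cast
    rfl

lemma HasMean.congr_posInd {F G : ℕ → ℝ} {d : ℝ} (hF : HasMean (posInd F) d)
    (h : ∀ᶠ n in atTop, (0 < G n ↔ 0 < F n)) : HasMean (posInd G) d := by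
  refine hF.congr_of_tendsto_sub (tendsto_const_nhds.congr' ?_)
  filter_upwards [h] with n hn
  simp [posInd, hn]

/-- For every real sequence `f` that is eventually a power sum, `{n | 0 < f n}` has a density.
Along the residue classes modulo a suitable `q`, the leading trigonometric sum is nondegenerate. -/
lemma exists_hasMean_posInd_of_powerSum {f : ℕ → ℝ} {P : ℂ →₀ Polynomial ℂ} (h0 : P 0 = 0)
    (hf : ∀ᶠ n in atTop, (f n : ℂ) = powerSum P n) : ∃ d, HasMean (posInd f) d := by
  have h0' : (0 : ℂ) ∉ P.support := by simpa using h0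
  obtain ⟨q, hq, hnd⟩ := exists_pow_nondegenerate P.support h0'
  refine exists_hasMean_of_residues (C := 1) (fun n => ?_) hq fun r _ => ?_
  · unfold posInd
    split_ifs <;> simp
  have hprog : Tendsto (fun m => q * m + r) atTop atTop :=
    tendsto_atTop_mono (fun m => (Nat.le_mul_of_pos_left m hq).trans (Nat.le_add_right _ _))
      tendsto_id
  set Q := decimate P q r with hQ
  have hfQ : ∀ᶠ m in atTop, (f (q * m + r) : ℂ) = powerSum Q m := by
    filter_upwards [hprog.eventually hf] with m hm
    rw [hm, powerSum_decimate]
  by_cases hQ0 : Q = 0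
  · refine ⟨0, hasMean_of_tendsto (tendsto_const_nhds.congr' ?_)⟩
    filter_upwards [hfQ] with m hm
    have : f (q * m + r) = 0 := by simpa [hQ0, powerSum] using hm
    simp [posInd, this]
  have hQ00 : Q 0 = 0 := by
    by_contra h
    obtain ⟨γ, hγ, hγq⟩ := exists_of_mem_support_decimate (Finsupp.mem_support_iff.2 h)
    rw [pow_eq_zero_iff hq.ne'] at hγq
    exact h0' (hγq ▸ hγ)
  obtain ⟨ρ, S, c, w, hρ, hne, hS, hc, hsupp, -, hw, hlim⟩ := exists_normalization hQ0 hQ00 hfQ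
  have hρC : (ρ : ℂ) ≠ 0 := by exact_mod_cast hρ.ne'
  obtain ⟨d, hd⟩ := exists_hasMean_posInd hne hS hc (fun α hα β hβ h hh heq => by
    obtain ⟨γ, hγ, hγα⟩ := exists_of_mem_support_decimate (hsupp α hα)
    obtain ⟨δ, hδ, hδβ⟩ := exists_of_mem_support_decimate (hsupp β hβ)
    have := hnd γ hγ δ hδ h hh (by rw [hγα, hδβ, mul_pow, mul_pow, heq])
    rw [hγα, hδβ] at this
    exact mul_left_cancel₀ hρC this) hlim
  refine ⟨d, hd.congr_posInd (F := fun m => f (q * m + r) / w m) (G := fun m => f (q * m + r)) ?_⟩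
  filter_upwards [hw] with m hm
  exact (div_pos_iff_of_pos_right hm).symm

/-! ### Recurrence sequences are eventually power sums -/

lemma powerSum_add (P Q : ℂ →₀ Polynomial ℂ) (n : ℕ) :
    powerSum (P + Q) n = powerSum P n + powerSum Q n :=
  Finsupp.sum_add_index' (by simp) (by intros; simp [add_mul])

lemma powerSum_smul (a : ℂ) (P : ℂ →₀ Polynomial ℂ) (n : ℕ) :
    powerSum (a • P) n = a * powerSum P n := by
  rw [powerSum, Finsupp.sum_smul_index' (by simp), powerSum, Finsupp.mul_sum]
  simp only [Polynomial.eval_smul, smul_eq_mul, mul_assoc]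

lemma powerSum_neg (P : ℂ →₀ Polynomial ℂ) (n : ℕ) : powerSum (-P) n = -powerSum P n := by
  rw [← neg_one_smul ℂ P, powerSum_smul, neg_one_mul]

/-- The space of complex sequences that are eventually equal to a power sum without the
root `0`. -/
def eventualPowerSums : Submodule ℂ (ℕ → ℂ) where
  carrier := {u | ∃ P : ℂ →₀ Polynomial ℂ, P 0 = 0 ∧ ∀ᶠ n in atTop, u n = powerSum P n}
  zero_mem' := ⟨0, rfl, by simp [powerSum]⟩
  add_mem' := by
    rintro u v ⟨P, hP, hu⟩ ⟨Q, hQ, hv⟩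
    refine ⟨P + Q, by simp [hP, hQ], ?_⟩
    filter_upwards [hu, hv] with n hn hn'
    rw [Pi.add_apply, hn, hn', powerSum_add]
  smul_mem' := by
    rintro a u ⟨P, hP, hu⟩
    refine ⟨a • P, by simp [hP], ?_⟩
    filter_upwards [hu] with n hn
    rw [Pi.smul_apply, hn, powerSum_smul, smul_eq_mul]

lemma polynomial_mul_pow_mem {γ : ℂ} (hγ : γ ≠ 0) (p : Polynomial ℂ) :
    (fun n : ℕ => p.eval (n : ℂ) * γ ^ n) ∈ eventualPowerSums := by
  refine ⟨Finsupp.single γ p, Finsupp.single_eq_of_ne hγ.symm, Eventually.of_forall fun n => ?_⟩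
  rw [powerSum, Finsupp.sum_single_index (by simp)]

lemma mem_of_eventuallyEq {u v : ℕ → ℂ} (hv : v ∈ eventualPowerSums)
    (h : ∀ᶠ n in atTop, u n = v n) : u ∈ eventualPowerSums := by
  obtain ⟨P, hP, hv⟩ := hv
  refine ⟨P, hP, ?_⟩
  filter_upwards [h, hv] with n h1 h2
  rw [h1, h2]

lemma choose_mul_pow_sub_mem (γ : ℂ) (j : ℕ) :
    (fun n : ℕ => (n.choose j : ℂ) * γ ^ (n - j)) ∈ eventualPowerSums := by
  by_cases hγ : γ = 0
  · refine mem_of_eventuallyEq (Submodule.zero_mem _) ?_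
    filter_upwards [eventually_gt_atTop j] with n hn
    simp [hγ, (Nat.sub_pos_of_lt hn).ne']
  · refine mem_of_eventuallyEq (polynomial_mul_pow_mem hγ
      (Polynomial.C ((j.factorial : ℂ)⁻¹ * (γ ^ j)⁻¹) * descPochhammer ℂ j)) ?_
    filter_upwards [eventually_ge_atTop j] with n hn
    rw [Polynomial.eval_mul, Polynomial.eval_C, descPochhammer_eval_eq_descFactorial,
      Nat.descFactorial_eq_factorial_mul_choose, pow_sub₀ _ hγ hn]
    have : (j.factorial : ℂ) ≠ 0 := by exact_mod_cast j.factorial_ne_zero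
    push_cast
    field_simp

/-- The shift operator on the solution space of a linear recurrence. -/
def shiftEnd (E : LinearRecurrence ℂ) : Module.End ℂ E.solSpace where
  toFun u := ⟨fun n => u.1 (n + 1), fun n => by
    have := u.2 (n + 1)
    simpa only [Nat.add_right_comm] using this⟩
  map_add' _ _ := rfl
  map_smul' _ _ := rfl

lemma shiftEnd_pow_apply_zero (E : LinearRecurrence ℂ) (u : E.solSpace) (n : ℕ) :
    ((shiftEnd E ^ n) u).1 0 = u.1 n := by
  suffices ∀ k, ((shiftEnd E ^ n) u).1 k = u.1 (k + n) by simpa using this 0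
  induction n with
  | zero => simp
  | succ n ih =>
    intro k
    rw [pow_succ', Module.End.mul_apply]
    change ((shiftEnd E ^ n) u).1 (k + 1) = _
    rw [ih, add_right_comm, add_assoc]

/-- The solution space is the sum of the generalized eigenspaces of the shift `T`. On the one
of `γ`, the binomial expansion of `T ^ n = (γ + (T - γ)) ^ n` has a bounded number of nonzero
terms. -/
lemma mem_eventualPowerSums_of_isSolution (E : LinearRecurrence ℂ) {u : ℕ → ℂ}
    (hu : E.IsSolution u) : u ∈ eventualPowerSums := by
  have : FiniteDimensional ℂ E.solSpace := Module.Basis.finiteDimensional_of_finite E.basis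
  suffices (⊤ : Submodule ℂ E.solSpace) ≤ eventualPowerSums.comap E.solSpace.subtype from
    this (Submodule.mem_top (x := ⟨u, hu⟩))
  rw [← Module.End.iSup_maxGenEigenspace_eq_top (shiftEnd E), iSup_le_iff]
  intro γ v hv
  obtain ⟨k, hk⟩ := (Module.End.mem_maxGenEigenspace _ _ _).1 hv
  set A := shiftEnd E - γ • (1 : Module.End ℂ E.solSpace) with hA
  have hAk : ∀ j ≥ k, (A ^ j) v = 0 := fun j hj => by
    rw [← Nat.sub_add_cancel hj, pow_add, Module.End.mul_apply, hk, map_zero]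
  rw [Submodule.mem_comap, Submodule.subtype_apply]
  refine mem_of_eventuallyEq (v := ∑ j ∈ range k, ((A ^ j) v).1 0 • fun n : ℕ =>
    (n.choose j : ℂ) * γ ^ (n - j))
    (Submodule.sum_mem _ fun j _ => Submodule.smul_mem _ _ (choose_mul_pow_sub_mem γ j)) ?_
  filter_upwards [eventually_ge_atTop k] with n hn
  have hcomm : Commute A (γ • (1 : Module.End ℂ E.solSpace)) :=
    (Commute.one_right A).smul_right γ
  have hexp : (shiftEnd E ^ n) v =
      ∑ j ∈ range (n + 1), ((n.choose j : ℂ) * γ ^ (n - j)) • (A ^ j) v := by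
    have : shiftEnd E = A + γ • (1 : Module.End ℂ E.solSpace) :=
      LinearMap.ext fun x => (sub_add_cancel (shiftEnd E x) (γ • x)).symm
    rw [this, hcomm.add_pow, LinearMap.sum_apply]
    refine sum_congr rfl fun j _ => ?_
    rw [smul_pow, one_pow, mul_smul_comm, mul_one, smul_mul_assoc, LinearMap.smul_apply,
      ← (Nat.cast_commute (n.choose j) (A ^ j)).eq, ← nsmul_eq_mul, LinearMap.smul_apply,
      ← Nat.cast_smul_eq_nsmul ℂ, smul_smul, mul_comm]
  rw [← shiftEnd_pow_apply_zero, hexp, Finset.sum_apply, ← sum_subset (range_mono (by omega : k ≤ n + 1))]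
  · rw [AddSubmonoidClass.coe_finsetSum, Finset.sum_apply]
    refine sum_congr rfl fun j _ => ?_
    simp [mul_comm]
  · intro j _ hj
    rw [hAk j (by simpa using hj), smul_zero]

/-! ### Natural densities -/

lemma HasMean.hasNaturalDensity {f : ℕ → ℝ} {d : ℝ} (h : HasMean (posInd f) d) :
    HasNaturalDensity {n | 0 < f n} d := by
  have h1 : Tendsto (fun x : ℕ => ((x + 1 : ℕ) : ℝ) / x) atTop (𝓝 1) := by
    have : Tendsto (fun x : ℕ => 1 + (x : ℝ)⁻¹) atTop (𝓝 1) := by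
      simpa using (tendsto_inv_atTop_nhds_zero_nat (𝕜 := ℝ)).const_add 1
    refine this.congr' ?_
    filter_upwards [eventually_gt_atTop 0] with x hx
    push_cast
    field_simp
  have h2 := h1.mul (h.comp (tendsto_add_atTop_nat 1))
  rw [one_mul] at h2
  refine h2.congr fun x => ?_
  have hset : {n : ℕ | n ≤ x ∧ n ∈ {n | 0 < f n}} = ({n ∈ range (x + 1) | 0 < f n} : Finset ℕ) := by
    ext n
    simp
  rw [hset, Set.ncard_coe_finset]
  simp only [Function.comp_apply, posInd, sum_boole, smul_eq_mul]
  have : ((x + 1 : ℕ) : ℝ) ≠ 0 := by positivity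
  field_simp

/-- A nonzero real power sum without a positive root of largest modulus is positive on a set of
positive density. -/
lemma exists_pos_hasNaturalDensity {f : ℕ → ℝ} {P : ℂ →₀ Polynomial ℂ} (hP : P ≠ 0) (h0 : P 0 = 0)
    (hf : ∀ᶠ n in atTop, (f n : ℂ) = powerSum P n)
    (hroot : ∀ r : ℝ, 0 < r → (r : ℂ) ∈ P.support → ¬ ∀ γ ∈ P.support, ‖γ‖ ≤ r) :
    ∃ d : ℝ, 0 < d ∧ HasNaturalDensity {n | 0 < f n} d := by
  obtain ⟨d, hd⟩ := exists_hasMean_posInd_of_powerSum h0 hf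
  obtain ⟨ρ, S, c, w, hρ, hne, hS, hc, hsupp, hle, hw, hlim⟩ := exists_normalization hP h0 hf
  refine ⟨d, pos_of_hasMean_posInd hne hS hc (fun h1 => ?_) hlim (hd.congr_posInd ?_),
    hd.hasNaturalDensity⟩
  · exact hroot ρ hρ (by simpa using hsupp 1 h1) hle
  · filter_upwards [hw] with n hn
    exact div_pos_iff_of_pos_right hn

/-- Uniqueness of the nonzero roots: they all occur in every power sum for `f` without the
root `0`. -/
lemma mem_support_of_isCharRoot {f : ℕ → ℝ} {P : ℂ →₀ Polynomial ℂ} (h0 : P 0 = 0)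
    (hf : ∀ᶠ n in atTop, (f n : ℂ) = powerSum P n) {γ : ℂ} (hγ : IsCharRoot f γ) :
    γ ∈ P.support := by
  obtain ⟨hγ0, Q, hQ, hγQ⟩ := hγ
  have hzero : ∀ᶠ n in atTop, powerSum (Q.erase 0 + -P) n = 0 := by
    filter_upwards [hf, hQ, eventually_gt_atTop 0] with n h1 h2 hn
    have h3 : powerSum Q n = powerSum (Finsupp.single 0 (Q 0)) n + powerSum (Q.erase 0) n := by
      rw [← powerSum_add, Finsupp.single_add_erase]
    have h4 : powerSum (Finsupp.single 0 (Q 0)) n = 0 := by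
      rw [powerSum, Finsupp.sum_single_index (by simp), zero_pow hn.ne', mul_zero]
    rw [h4, zero_add] at h3
    rw [powerSum_add, powerSum_neg, ← h3, ← h1, h2, powerSum, add_neg_cancel]
  have heq := eq_zero_of_eventually_powerSum_eq_zero (by simp [h0]) hzero
  rw [← sub_eq_add_neg, sub_eq_zero] at heq
  rw [← heq, Finsupp.support_erase]
  exact mem_erase.2 ⟨hγ0, hγQ⟩

end RecurrenceSign

theorem theorem2 (f : ℕ → ℝ) (hf : IsRecurrenceSequence f)
    (hne : ¬ ∀ᶠ n : ℕ in atTop, f n = 0)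
    (hroot : ¬ ∃ r : ℝ, 0 < r ∧ IsDominatingRoot f (r : ℂ)) :
    (∃ d : ℝ, 0 < d ∧ HasNaturalDensity {n : ℕ | 0 < f n} d) ∧
      (∃ d : ℝ, 0 < d ∧ HasNaturalDensity {n : ℕ | f n < 0} d) := by
  obtain ⟨E, hE⟩ := hf
  obtain ⟨P, h0, hP⟩ := RecurrenceSign.mem_eventualPowerSums_of_isSolution
    ⟨E.order, fun i => (E.coeffs i : ℂ)⟩ (u := fun n => (f n : ℂ)) fun n => by
      simp only [hE n]
      push_cast
      rfl
  have hP0 : P ≠ 0 := by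
    rintro rfl
    refine hne ?_
    filter_upwards [hP] with n hn
    simpa [RecurrenceSign.powerSum] using hn
  have hdom : ∀ r : ℝ, 0 < r → (r : ℂ) ∈ P.support → ¬ ∀ γ ∈ P.support, ‖γ‖ ≤ r := by
    intro r hr hrP hmax
    refine hroot ⟨r, hr, ⟨by exact_mod_cast hr.ne', P, hP, hrP⟩, fun δ hδ => ?_⟩
    rw [Complex.norm_real, Real.norm_eq_abs, abs_of_pos hr]
    exact hmax δ (RecurrenceSign.mem_support_of_isCharRoot h0 hP hδ)
  refine ⟨RecurrenceSign.exists_pos_hasNaturalDensity hP0 h0 hP hdom, ?_⟩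
  have hneg : ∀ᶠ n in atTop, ((-f n : ℝ) : ℂ) = RecurrenceSign.powerSum (-P) n := by
    filter_upwards [hP] with n hn
    rw [RecurrenceSign.powerSum_neg, ← hn, Complex.ofReal_neg]
  simpa using RecurrenceSign.exists_pos_hasNaturalDensity (f := fun n => -f n) (neg_ne_zero.2 hP0)
    (by simpa using h0) hneg (by simpa only [Finsupp.support_neg] using hdom)
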